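/- **Theorem.** There is an absolute constant $C$ such that the following holds for every natural number $m$ and every real number $A$ with $m^2 \le A < 2^m - 1$. Choose $(p,q)$ uniformly at random among all ordered pairs of distinct primes of binary length $m$, that is, with $2^{m-1} \le p \ne q \le 2^m - 1$; put $N = pq$; and then choose $g$ uniformly at random in $\mathbb{Z}_N^* = (\mathbb{Z}/N\mathbb{Z})^*$. Let $\omega_N(g)$ denote the order of $g$ in the group $\mathbb{Z}_N^*$, and let $\varphi$ be Euler's totient function. Then $$\Pr\left[\,\omega_N(g) < \frac{1}{A}\,\varphi(N)\right] \;\le\; C\,\frac{m^{2/5}}{A^{1/5}},$$ where the probability is over the random choice of $(p,q)$ and $g$. -/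

import Mathlib

/-- Ordered pairs of distinct primes of binary length `m`, i.e. `2^(m-1) ≤ p ≠ q ≤ 2^m - 1`. -/
def primePairs (m : ℕ) : Finset (ℕ × ℕ) :=
  (Finset.Ico (2 ^ (m - 1)) (2 ^ m) ×ˢ Finset.Ico (2 ^ (m - 1)) (2 ^ m)).filter
    fun pq => pq.1.Prime ∧ pq.2.Prime ∧ pq.1 ≠ pq.2

/-- The probability, over a uniformly random element `g` of the unit group of `ℤ/Nℤ`, that the
order of `g` is less than `φ(N) / A`. -/
noncomputable def shortOrderProb (N : ℕ) (A : ℝ) : ℝ :=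
  (Nat.card {g : (ZMod N)ˣ // (orderOf g : ℝ) < 1 / A * (N.totient : ℝ)} : ℝ) /
    (Nat.card (ZMod N)ˣ : ℝ)

/-- The probability of the event `ω_N(g) < φ(N) / A` when first `(p, q)` is uniformly random among
the ordered pairs of distinct primes of binary length `m`, and then, with `N = p * q`, `g` is
uniformly random in the unit group of `ℤ/Nℤ`. -/
noncomputable def randomShortOrderProb (m : ℕ) (A : ℝ) : ℝ :=
  (∑ pq ∈ primePairs m, shortOrderProb (pq.1 * pq.2) A) / ((primePairs m).card : ℝ)

/-!
Put `T = A ^ (1 / 3)` and write `g` as a pair `(a, b)` in `(ℤ/p)ˣ × (ℤ/q)ˣ`. If the orders of `a`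
and `b` are `(p - 1) / s` and `(q - 1) / t`, then `φ(N)` is at most `s * t * gcd (p - 1) (q - 1)`
times the order of `g`, so an order below `φ(N) / A` forces `s > T`, `t > T` or
`gcd (p - 1) (q - 1) > T` (`lt_card_or_lt_card_of_orderOf_prod`). Since `(ℤ/p)ˣ` is cyclic, the
index of a random `a` equals `s` with probability at most `1 / s`, and only if `s ∣ p - 1`. After
averaging over `p` and `q`, everything depends on the proportion of `m`-bit primes that are
`1` modulo `d`, for `d > T` (`sum_shortOrderProb_le`).

That proportion is `O(log d / d)`, with no dependence on `m`, and this needs no sieve. With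
`X = 2 ^ m` and `n = ⌊(X - 1) / d⌋`, the factorial `n !` divides `d ^ n * ∏ (d * j + 1)` over
`1 ≤ j ≤ n`, just as it divides a product of `n` consecutive integers. Every prime
`p ≡ 1 (mod d)` in `[X / 2, X)` occurs among the factors `d * j + 1` and exceeds `n`, so it divides
the quotient, which is at most `(2 * d ^ 2) ^ n`; hence there are `O((X / d) * (log d / log X))`
such primes (`pow_card_dyadicPrimes_modEq_one_le`). Chebyshev's lower bound `≫ X / log X` for the
number of all primes in `[X / 2, X)` (`two_pow_le_mul_card_dyadicPrimes`) turns this into a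
proportion (`card_dyadicPrimes_modEq_one_le`).

Bounding `log d` by a multiple of `d ^ (1 / 5)`, both the contribution of a large index and that of
a large gcd are `O(∑_{d > T} d ^ (-8 / 5)) = O(T ^ (-3 / 5)) = O(A ^ (-1 / 5))`, which is stronger
than the claim.
-/

/-! ### Chebyshev's lower bound for primes of given binary length -/

open Finset in
/-- The part of the proof of Bertrand's postulate that does not assume the absence of primes in
`(n, 2 * n]`: each such prime contributes a factor of at most `2 * n`. -/
theorem Nat.centralBinom_le_mul_pow_card_primes {n : ℕ} (hn : 2 < n) :
    n.centralBinom ≤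
      (2 * n) ^ Nat.sqrt (2 * n) * 4 ^ (2 * n / 3) * (2 * n) ^ #{p ∈ Ioc n (2 * n) | p.Prime} := by
  set f : ℕ → ℕ := fun p => p ^ n.centralBinom.factorization p
  set S := {p ∈ range (2 * n + 1) | p.Prime}
  have hS : ∏ p ∈ S, f p = n.centralBinom := by
    rw [← n.prod_pow_factorization_centralBinom]
    refine prod_filter_of_ne fun p _ h => ?_
    contrapose h
    simp [f, Nat.factorization_eq_zero_of_not_prime _ h]
  -- The three factors account for `p ≤ √(2n)`, for `√(2n) < p ≤ 2n/3`, where the exponent is at most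
  -- one, and for `p > n`; primes in `(2n/3, n]` do not divide the central binomial coefficient.
  have key : ∀ p ∈ S, f p ≤ (if p ≤ Nat.sqrt (2 * n) then 2 * n else 1) *
      (if p ≤ 2 * n / 3 then p else 1) * (if n < p then 2 * n else 1) := by
    intro p hp
    have hpp : p.Prime := (mem_filter.1 hp).2
    have hbound : f p ≤ 2 * n := Nat.pow_factorization_choose_le (by omega)
    by_cases h1 : p ≤ Nat.sqrt (2 * n)
    · rw [if_pos h1, mul_assoc]
      refine hbound.trans (Nat.le_mul_of_pos_right _ (Nat.mul_pos ?_ ?_))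
      · split_ifs <;> simp [hpp.pos]
      · split_ifs <;> omega
    rw [if_neg h1, one_mul]
    by_cases h3 : n < p
    · rw [if_pos h3]
      refine hbound.trans (Nat.le_mul_of_pos_left _ ?_)
      split_ifs <;> simp [hpp.pos]
    rw [if_neg h3, mul_one]
    by_cases h2 : p ≤ 2 * n / 3
    · rw [if_pos h2]
      refine (Nat.pow_le_pow_right hpp.pos
        (Nat.factorization_choose_le_one (Nat.sqrt_lt'.mp (not_le.1 h1)))).trans (pow_one p).le
    · rw [if_neg h2]
      simp only [f]
      rw [Nat.factorization_centralBinom_of_two_mul_self_lt_three_mul hn (by omega) (by omega),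
        pow_zero]
  rw [← hS]
  refine (prod_le_prod' key).trans ?_
  rw [prod_mul_distrib, prod_mul_distrib]
  refine Nat.mul_le_mul (Nat.mul_le_mul ?_ ?_) ?_
  · rw [← prod_filter, prod_const]
    refine Nat.pow_le_pow_right (by omega) ?_
    refine (card_le_card (t := Icc 1 (Nat.sqrt (2 * n))) fun p hp => ?_).trans (by simp)
    simp only [S, mem_filter, mem_Icc] at hp ⊢
    exact ⟨hp.1.2.pos, hp.2⟩
  · rw [← prod_filter]
    refine le_trans (le_of_eq (prod_congr ?_ fun _ _ => rfl)) (primorial_le_four_pow (2 * n / 3))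
    ext p
    simp only [S, mem_filter, mem_range]
    refine ⟨fun h => ⟨by omega, h.1.2⟩, fun h => ⟨⟨by omega, h.2⟩, by omega⟩⟩
  · rw [← prod_filter, prod_const]
    refine Nat.pow_le_pow_right (by omega) (card_le_card fun p hp => ?_)
    simp only [S, mem_filter, mem_range, mem_Ioc] at hp ⊢
    exact ⟨⟨hp.2, by omega⟩, hp.1.2⟩

/-- The primes of binary length `m`. -/
def dyadicPrimes (m : ℕ) : Finset ℕ :=
  (Finset.Ico (2 ^ (m - 1)) (2 ^ m)).filter Nat.Prime

theorem mem_dyadicPrimes {m p : ℕ} :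
    p ∈ dyadicPrimes m ↔ (2 ^ (m - 1) ≤ p ∧ p < 2 ^ m) ∧ p.Prime := by
  simp [dyadicPrimes]

/-- At least `2 ^ m / (6 * m)` primes have binary length `m`. -/
theorem two_pow_le_mul_card_dyadicPrimes {m : ℕ} (hm : 16 ≤ m) :
    2 ^ m ≤ 6 * m * (dyadicPrimes m).card := by
  obtain ⟨t, rfl⟩ : ∃ t, m = t + 1 := ⟨m - 1, by omega⟩
  set n := 2 ^ t with hn
  have hn2 : 2 ^ (t + 1) = 2 * n := by rw [pow_succ, mul_comm]
  have hn4 : 4 ≤ n := by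
    calc 4 = 2 ^ 2 := rfl
      _ ≤ 2 ^ t := Nat.pow_le_pow_right (by norm_num) (by omega)
  set k := (dyadicPrimes (t + 1)).card
  set s := Nat.sqrt (2 * n)
  have hk : ({p ∈ Finset.Ioc n (2 * n) | p.Prime} : Finset ℕ).card ≤ k := by
    refine Finset.card_le_card fun p hp => ?_
    rw [Finset.mem_filter, Finset.mem_Ioc] at hp
    rw [mem_dyadicPrimes, hn2, Nat.add_sub_cancel]
    refine ⟨⟨hp.1.1.le, lt_of_le_of_ne hp.1.2 ?_⟩, hp.2⟩
    rintro rfl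
    exact (Nat.not_prime_mul (by norm_num) (by omega)) hp.2
  have h1 : 2 ^ (2 * n) ≤ 2 ^ (t + ((t + 1) * s + 2 * (2 * n / 3) + (t + 1) * k)) := by
    calc 2 ^ (2 * n) = 4 ^ n := pow_mul 2 2 n
      _ ≤ n * n.centralBinom := (Nat.four_pow_lt_mul_centralBinom n hn4).le
      _ ≤ n * ((2 * n) ^ s * 4 ^ (2 * n / 3) * (2 * n) ^ k) := by
          refine Nat.mul_le_mul_left _
            ((Nat.centralBinom_le_mul_pow_card_primes (by omega)).trans ?_)
          exact Nat.mul_le_mul_left _ (Nat.pow_le_pow_right (by omega) hk)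
      _ = _ := by
          rw [← hn2, show 4 = 2 ^ 2 from rfl, ← pow_mul, ← pow_mul, ← pow_mul, hn]
          simp only [← pow_add]
  have h2 := (Nat.pow_le_pow_iff_right (by norm_num)).1 h1
  have h3 : 144 * (t + 1) ^ 2 ≤ 2 * n := by
    rw [← hn2]
    generalize t + 1 = m at hm
    induction m, hm using Nat.le_induction with
    | base => norm_num
    | succ m hm ih => rw [pow_succ 2 m]; nlinarith
  have hs : s * s ≤ 2 * n := Nat.sqrt_le _
  have hs1 : 1 ≤ s := Nat.le_sqrt.2 (by omega)
  -- Hence the terms `t + (t + 1) * s` in `h2` are at most half of the main term `2n/3`.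
  have h4 : 12 * ((t + 1) * s) ≤ 2 * n := by
    refine Nat.pow_le_pow_iff_left two_ne_zero |>.1 ?_
    calc (12 * ((t + 1) * s)) ^ 2 = (144 * (t + 1) ^ 2) * (s * s) := by ring
      _ ≤ (2 * n) * (2 * n) := Nat.mul_le_mul h3 hs
      _ = _ := by ring
  have h5 : t + 1 ≤ (t + 1) * s := Nat.le_mul_of_pos_right _ hs1
  rw [hn2, mul_assoc]
  omega

/-! ### Primes congruent to one modulo `d` -/

open Nat in
/-- Primes dividing `d` are absorbed by `d ^ n`. Modulo a power of any other prime `d` is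
invertible, and the product becomes a unit times a product of `n` consecutive integers. -/
theorem Nat.factorial_dvd_pow_mul_prod_arith (d n : ℕ) :
    n ! ∣ d ^ n * ∏ j ∈ Finset.range n, (d * (j + 1) + 1) := by
  rw [Nat.dvd_iff_prime_pow_dvd_dvd]
  intro l v hl hv
  by_cases hld : l ∣ d
  · have : Fact l.Prime := ⟨hl⟩
    have h1 : v ≤ padicValNat l n ! := (padicValNat_dvd_iff_le n.factorial_ne_zero).1 hv
    have h2 := sub_one_mul_padicValNat_factorial (p := l) n
    have h3 : padicValNat l n ! ≤ n := by
      have := Nat.le_mul_of_pos_left (padicValNat l n !) (Nat.sub_pos_of_lt hl.one_lt)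
      omega
    exact ((pow_dvd_pow l (h1.trans h3)).trans (pow_dvd_pow_of_dvd hld n)).mul_right _
  · refine Dvd.dvd.mul_left ?_ _
    have hco : d.Coprime (l ^ v) :=
      Nat.Coprime.pow_right v ((Nat.Prime.coprime_iff_not_dvd hl).2 hld).symm
    have : NeZero (l ^ v) := ⟨pow_ne_zero v hl.ne_zero⟩
    obtain ⟨u, hu⟩ := (ZMod.isUnit_iff_coprime d (l ^ v)).2 hco
    obtain ⟨e, he⟩ := ZMod.natCast_zmod_surjective (n := l ^ v)
      ((u⁻¹ : (ZMod (l ^ v))ˣ) : ZMod (l ^ v))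
    have hasc : (((e + 1).ascFactorial n : ℕ) : ZMod (l ^ v)) = 0 :=
      (ZMod.natCast_eq_zero_iff _ _).2 (hv.trans (Nat.factorial_dvd_ascFactorial _ _))
    rw [← ZMod.natCast_eq_zero_iff, Nat.cast_prod]
    have hfac : ∀ j ∈ Finset.range n, ((d * (j + 1) + 1 : ℕ) : ZMod (l ^ v)) =
        u * ((e + 1 + j : ℕ) : ZMod (l ^ v)) := by
      intro j _
      push_cast
      rw [he, ← hu, mul_add, mul_add, mul_add, Units.mul_inv]
      ring
    rw [Finset.prod_congr rfl hfac, Finset.prod_mul_distrib, ← Nat.cast_prod,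
      ← Nat.ascFactorial_eq_prod_range, hasc, mul_zero]

open Nat in
/-- The product of the primes `p ≡ 1 (mod d)` of binary length `m` is bounded by the integer
`d ^ n * ∏ (d * j + 1) / n !`, which they all divide. -/
theorem pow_card_dyadicPrimes_modEq_one_le {m d : ℕ} (hm : 1 ≤ m) (hd : 2 ≤ d) :
    (2 ^ (m - 1)) ^ ((dyadicPrimes m).filter (d ∣ · - 1)).card ≤
      (2 * d ^ 2) ^ ((2 ^ m - 1) / d) := by
  set n := (2 ^ m - 1) / d
  set P := (dyadicPrimes m).filter (d ∣ · - 1)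
  have hpow : 2 ^ m = 2 * 2 ^ (m - 1) := by rw [← pow_succ']; congr; omega
  have hP : ∀ p ∈ P, 2 ^ (m - 1) ≤ p ∧ p < 2 ^ m ∧ p.Prime ∧ d ∣ p - 1 := by
    intro p hp
    obtain ⟨h1, h2⟩ := Finset.mem_filter.1 hp
    obtain ⟨h3, h4⟩ := mem_dyadicPrimes.1 h1
    exact ⟨h3.1, h3.2, h4, h2⟩
  have hn : n < 2 ^ (m - 1) := by
    refine (Nat.div_lt_iff_lt_mul (by omega)).2 ?_
    have := Nat.mul_le_mul_left (2 ^ (m - 1)) hd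
    have := Nat.two_pow_pos (m - 1)
    omega
  have hdvd : (∏ p ∈ P, p) ∣ d ^ n * ∏ j ∈ Finset.range n, (d * (j + 1) + 1) := by
    refine Dvd.dvd.mul_left (Finset.prod_primes_dvd _ (fun p hp => (hP p hp).2.2.1.prime) ?_) _
    intro p hp
    obtain ⟨-, h2, h3, c, hc⟩ := hP p hp
    have hc0 : 0 < c := by
      rcases Nat.eq_zero_or_pos c with rfl | h
      · have := h3.two_le
        omega
      · exact h
    have hcn : c ≤ n := (Nat.le_div_iff_mul_le (by omega)).2 (by rw [mul_comm]; omega)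
    have hpc : p = d * (c - 1 + 1) + 1 := by
      rw [Nat.sub_add_cancel hc0, ← hc]
      have := h3.two_le
      omega
    conv_lhs => rw [hpc]
    exact Finset.dvd_prod_of_mem (fun j => d * (j + 1) + 1) (Finset.mem_range.2 (by omega))
  have hco : Nat.Coprime (∏ p ∈ P, p) n ! := by
    refine Nat.Coprime.prod_left fun p hp => ?_
    obtain ⟨h1, -, h3, -⟩ := hP p hp
    rw [h3.coprime_iff_not_dvd, h3.dvd_factorial]
    omega
  have hle := Nat.le_of_dvd (by positivity) (hco.mul_dvd_of_dvd_of_dvd hdvd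
    (Nat.factorial_dvd_pow_mul_prod_arith d n))
  have hprod : ∏ j ∈ Finset.range n, (d * (j + 1) + 1) ≤ (2 * d) ^ n * n ! := by
    rw [← Finset.prod_range_add_one_eq_factorial]
    calc _ ≤ ∏ j ∈ Finset.range n, (2 * d * (j + 1)) := by
          refine Finset.prod_le_prod' fun j _ => ?_
          have : 1 ≤ d * (j + 1) := Nat.mul_pos (by omega) (by omega)
          rw [mul_assoc]
          omega
      _ = _ := by rw [Finset.prod_mul_distrib, Finset.prod_const, Finset.card_range]
  refine Nat.le_of_mul_le_mul_right (c := n !) ?_ n.factorial_pos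
  calc (2 ^ (m - 1)) ^ P.card * n ! ≤ (∏ p ∈ P, p) * n ! := by
        refine Nat.mul_le_mul_right _ ?_
        rw [← Finset.prod_const]
        exact Finset.prod_le_prod' fun p hp => (hP p hp).1
    _ ≤ d ^ n * ((2 * d) ^ n * n !) := hle.trans (Nat.mul_le_mul_left _ hprod)
    _ = (2 * d ^ 2) ^ n * n ! := by rw [← mul_assoc, ← mul_pow]; ring_nf

/-- A proportion `O(d ^ (-4 / 5))` of the primes of binary length `m` is congruent to `1` modulo
`d`, uniformly in `m`. -/
theorem card_dyadicPrimes_modEq_one_le {m d : ℕ} (hm : 16 ≤ m) (hd : 1 ≤ d) :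
    (((dyadicPrimes m).filter (d ∣ · - 1)).card : ℝ) ≤
      140 * (dyadicPrimes m).card * (d : ℝ) ^ (-(4 / 5) : ℝ) := by
  have hk0 : (0 : ℝ) ≤ (dyadicPrimes m).card := Nat.cast_nonneg _
  rcases hd.eq_or_lt with rfl | hd
  · simp
    linarith
  set k := (dyadicPrimes m).card
  set c := ((dyadicPrimes m).filter (d ∣ · - 1)).card
  have hd2 : (2 : ℝ) ≤ d := by exact_mod_cast hd
  have hd0 : (0 : ℝ) < d := by linarith
  have hlogd : Real.log 2 ≤ Real.log d := Real.log_le_log (by norm_num) hd2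
  have hlog2 := Real.log_two_gt_d9
  have hmR : (16 : ℝ) ≤ m := by exact_mod_cast hm
  have hk : (2 : ℝ) ^ m ≤ 6 * m * k := by exact_mod_cast two_pow_le_mul_card_dyadicPrimes hm
  have hpow : ((2 : ℝ) ^ (m - 1)) ^ c ≤ (2 * (d : ℝ) ^ 2) ^ ((2 ^ m - 1) / d) := by
    exact_mod_cast pow_card_dyadicPrimes_modEq_one_le (m := m) (by omega) hd
  have hlog := Real.log_le_log (by positivity) hpow
  rw [Real.log_pow, Real.log_pow, Real.log_pow, Real.log_mul (by norm_num) (by positivity),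
    Real.log_pow, Nat.cast_sub (by omega)] at hlog
  have hn : (((2 ^ m - 1) / d : ℕ) : ℝ) ≤ 6 * m * k / d := by
    refine Nat.cast_div_le.trans ?_
    gcongr
    refine le_trans ?_ hk
    exact_mod_cast Nat.sub_le _ _
  have h1 : (c : ℝ) * ((m - 1) * Real.log 2) ≤ 6 * m * k / d * (3 * Real.log d) := by
    push_cast at hlog
    refine hlog.trans (mul_le_mul hn (by linarith) (by positivity) (by positivity))
  have h2 : Real.log d ≤ 5 * (d : ℝ) ^ (1 / 5 : ℝ) := by
    have := Real.log_le_rpow_div hd0.le (show (0 : ℝ) < 1 / 5 by norm_num)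
    linarith
  have h3 : (d : ℝ) ^ (-(4 / 5) : ℝ) = (d : ℝ) ^ (1 / 5 : ℝ) / d := by
    rw [← Real.rpow_sub_one hd0.ne']; norm_num
  -- `0.6464 < (15 / 16) * log 2`, and `m - 1 ≥ (15 / 16) * m`.
  have h4 : (m : ℝ) * 0.6464 ≤ (m - 1) * Real.log 2 := by nlinarith
  have h5 : (c : ℝ) * (m * 0.6464) ≤ m * (90 * k * (d : ℝ) ^ (-(4 / 5) : ℝ)) := by
    calc (c : ℝ) * (m * 0.6464) ≤ c * ((m - 1) * Real.log 2) := by gcongr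
      _ ≤ 6 * m * k / d * (3 * (5 * (d : ℝ) ^ (1 / 5 : ℝ))) := by
          refine h1.trans ?_
          gcongr
      _ = _ := by rw [h3]; ring
  have h6 : (c : ℝ) * 0.6464 ≤ 90 * k * (d : ℝ) ^ (-(4 / 5) : ℝ) := by
    refine le_of_mul_le_mul_left ?_ (show (0 : ℝ) < m by linarith)
    linarith
  have : 0 ≤ k * (d : ℝ) ^ (-(4 / 5) : ℝ) := by positivity
  linarith

theorem sum_rpow_tail_le {T : ℝ} (hT : 1 ≤ T) (N : ℕ) :
    ∑ d ∈ (Finset.range N).filter (fun d : ℕ => T < d), (d : ℝ) ^ (-(8 / 5) : ℝ) ≤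
      4 * T ^ (-(3 / 5) : ℝ) := by
  have hT0 : 0 < T := by linarith
  set a := ⌊T⌋₊
  have ha1 : 1 ≤ a := Nat.le_floor (by simpa using hT)
  have ha : (1 : ℝ) ≤ a := by exact_mod_cast ha1
  have hTa : T ≤ 2 * a := by
    have := (Nat.lt_floor_add_one T).le
    linarith
  have hsub : ∑ d ∈ (Finset.range N).filter (fun d : ℕ => T < d), (d : ℝ) ^ (-(8 / 5) : ℝ) ≤
      ∑ i ∈ Finset.Ico a (a + N), ((i + 1 : ℕ) : ℝ) ^ (-(8 / 5) : ℝ) := by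
    rw [Finset.sum_Ico_add' (fun i : ℕ => (i : ℝ) ^ (-(8 / 5) : ℝ)) a (a + N) 1]
    refine Finset.sum_le_sum_of_subset_of_nonneg (fun d hd => ?_) fun _ _ _ => by positivity
    rw [Finset.mem_filter, Finset.mem_range] at hd
    have := (Nat.floor_lt hT0.le).2 hd.2
    rw [Finset.mem_Ico]
    omega
  have hanti : AntitoneOn (fun x : ℝ => x ^ (-(8 / 5) : ℝ)) (Set.Icc (a : ℝ) ((a + N : ℕ) : ℝ)) :=
    fun x hx y _ hxy => Real.rpow_le_rpow_of_nonpos (by linarith [hx.1]) hxy (by norm_num)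
  refine hsub.trans ((hanti.sum_le_integral_Ico (by omega)).trans ?_)
  rw [integral_rpow (Or.inr ⟨by norm_num, ?_⟩)]
  · have h1 : (0 : ℝ) ≤ ((a + N : ℕ) : ℝ) ^ (-(3 / 5) : ℝ) := by positivity
    have h2 : (2 * a : ℝ) ^ (-(3 / 5) : ℝ) ≤ T ^ (-(3 / 5) : ℝ) :=
      Real.rpow_le_rpow_of_nonpos hT0 hTa (by norm_num)
    rw [Real.mul_rpow (by norm_num) (by positivity)] at h2
    have h3 : (1 / 2 : ℝ) ≤ (2 : ℝ) ^ (-(3 / 5) : ℝ) := by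
      rw [one_div, ← Real.rpow_neg_one]
      exact Real.rpow_le_rpow_of_exponent_le (by norm_num) (by norm_num)
    have h4 : (0 : ℝ) ≤ (a : ℝ) ^ (-(3 / 5) : ℝ) := by positivity
    rw [show (-(8 / 5) + 1 : ℝ) = -(3 / 5) by norm_num]
    have h5 : (0 : ℝ) ≤ T ^ (-(3 / 5) : ℝ) := by positivity
    nlinarith
  · rw [Set.uIcc_of_le (by exact_mod_cast (by omega))]
    intro h
    linarith [h.1]

/-! ### Orders of random elements -/

/-- In a cyclic group of order `n`, a random element has index `s` with probability at most `1 / s`,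
because its order then divides `n / s`. Here the index of `a` is `n / orderOf a`, and the
condition `T * orderOf a < n` says that it exceeds `T`. -/
theorem card_index_gt_le {G : Type*} [Group G] [Finite G] [IsCyclic G] (T : ℝ) :
    (Nat.card {a : G // T * orderOf a < Nat.card G} : ℝ) / Nat.card G ≤
      ∑ s ∈ (Nat.card G).divisors.filter (fun s : ℕ => T < s), (1 / s : ℝ) := by
  classical
  have := Fintype.ofFinite G
  set n := Nat.card G
  have hn : 0 < n := Nat.card_pos
  set D := n.divisors.filter (fun s : ℕ => T < s)
  have hsub : Finset.univ.filter (fun a : G => T * orderOf a < n) ⊆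
      D.biUnion fun s => Finset.univ.filter fun a : G => a ^ (n / s) = 1 := by
    intro a ha
    have ha := (Finset.mem_filter.1 ha).2
    obtain ⟨s, hs⟩ : orderOf a ∣ n := orderOf_dvd_natCard a
    have ho : 0 < orderOf a := orderOf_pos a
    have hs0 : 0 < s := Nat.pos_of_ne_zero (by rintro rfl; omega)
    rw [Finset.mem_biUnion]
    refine ⟨s, Finset.mem_filter.2 ⟨Nat.mem_divisors.2 ⟨⟨_, hs.trans (mul_comm _ _)⟩, hn.ne'⟩, ?_⟩,
      Finset.mem_filter.2 ⟨Finset.mem_univ _, ?_⟩⟩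
    · rw [hs, Nat.cast_mul, mul_comm] at ha
      exact lt_of_mul_lt_mul_left ha (Nat.cast_nonneg _)
    · rw [hs, Nat.mul_div_cancel _ hs0, pow_orderOf_eq_one]
  have hcard : Nat.card {a : G // T * orderOf a < n} ≤ ∑ s ∈ D, n / s := by
    rw [Nat.card_eq_fintype_card, Fintype.card_subtype]
    refine (Finset.card_le_card hsub).trans (Finset.card_biUnion_le.trans ?_)
    refine Finset.sum_le_sum fun s hs => IsCyclic.card_pow_eq_one_le ?_
    exact Nat.div_pos (Nat.divisor_le (Finset.mem_filter.1 hs).1)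
      (Nat.pos_of_mem_divisors (Finset.mem_filter.1 hs).1)
  rw [div_le_iff₀ (by exact_mod_cast hn), Finset.sum_mul]
  refine (Nat.cast_le.2 hcard).trans ?_
  rw [Nat.cast_sum]
  refine Finset.sum_le_sum fun s _ => Nat.cast_div_le.trans (le_of_eq (by ring))

/-- If the group orders have a small gcd, then an element of small order in a product has a
component of large index. -/
theorem lt_card_or_lt_card_of_orderOf_prod {G H : Type*} [Group G] [Group H] [Finite G] [Finite H]
    {T : ℝ} (hT : 0 < T) (hgcd : ((Nat.card G).gcd (Nat.card H) : ℝ) ≤ T) {x : G × H}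
    (hx : T ^ 3 * orderOf x < Nat.card G * Nat.card H) :
    T * orderOf x.1 < Nat.card G ∨ T * orderOf x.2 < Nat.card H := by
  by_contra! h
  refine hx.not_ge ?_
  have h1 : ((orderOf x.1).gcd (orderOf x.2) : ℝ) ≤ T := by
    refine le_trans ?_ hgcd
    exact_mod_cast Nat.le_of_dvd (Nat.gcd_pos_of_pos_left _ Nat.card_pos)
      (Nat.gcd_dvd_gcd_of_dvd_left _ (orderOf_dvd_natCard _) |>.trans
        (Nat.gcd_dvd_gcd_of_dvd_right _ (orderOf_dvd_natCard _)))
  have h2 : ((orderOf x.1).gcd (orderOf x.2) : ℝ) * orderOf x = orderOf x.1 * orderOf x.2 := by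
    rw [Prod.orderOf]
    exact_mod_cast Nat.gcd_mul_lcm _ _
  calc (Nat.card G * Nat.card H : ℝ) ≤ (T * orderOf x.1) * (T * orderOf x.2) :=
        mul_le_mul h.1 h.2 (Nat.cast_nonneg _) (by positivity)
    _ = T ^ 2 * ((orderOf x.1).gcd (orderOf x.2) * orderOf x) := by rw [h2]; ring
    _ ≤ T ^ 2 * (T * orderOf x) := by gcongr
    _ = _ := by ring

theorem card_orderOf_prod_lt_le {G H : Type*} [Group G] [Group H] [Finite G] [Finite H]
    {T : ℝ} (hT : 0 < T) (hgcd : ((Nat.card G).gcd (Nat.card H) : ℝ) ≤ T) :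
    (Nat.card {x : G × H // T ^ 3 * orderOf x < Nat.card G * Nat.card H} : ℝ) /
        (Nat.card G * Nat.card H) ≤
      (Nat.card {a : G // T * orderOf a < Nat.card G} : ℝ) / Nat.card G +
      (Nat.card {b : H // T * orderOf b < Nat.card H} : ℝ) / Nat.card H := by
  classical
  have := Fintype.ofFinite G
  have := Fintype.ofFinite H
  have hG : (0 : ℝ) < Nat.card G := by exact_mod_cast Nat.card_pos
  have hH : (0 : ℝ) < Nat.card H := by exact_mod_cast Nat.card_pos
  set S := Finset.univ.filter fun a : G => T * orderOf a < Nat.card G with hS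
  set S' := Finset.univ.filter fun b : H => T * orderOf b < Nat.card H with hS'
  have hsub : Finset.univ.filter
      (fun x : G × H => T ^ 3 * orderOf x < Nat.card G * Nat.card H) ⊆
      S ×ˢ Finset.univ ∪ Finset.univ ×ˢ S' := by
    intro x hx
    have := lt_card_or_lt_card_of_orderOf_prod hT hgcd (Finset.mem_filter.1 hx).2
    simpa [S, S'] using this
  have hle := (Finset.card_le_card hsub).trans (Finset.card_union_le _ _)
  rw [Finset.card_product, Finset.card_product, Finset.card_univ, Finset.card_univ,
    ← Nat.card_eq_fintype_card, ← Nat.card_eq_fintype_card] at hle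
  rw [Nat.card_eq_fintype_card (α := {x : G × H // _}), Nat.card_eq_fintype_card (α := {x : G // _}),
    Nat.card_eq_fintype_card (α := {x : H // _}),
    Fintype.card_subtype, Fintype.card_subtype, Fintype.card_subtype, ← hS, ← hS',
    div_add_div _ _ hG.ne' hH.ne']
  gcongr
  exact_mod_cast hle

theorem shortOrderProb_le_one {N : ℕ} (hN : N ≠ 0) (A : ℝ) : shortOrderProb N A ≤ 1 := by
  have : NeZero N := ⟨hN⟩
  refine div_le_one_of_le₀ ?_ (Nat.cast_nonneg _)
  exact_mod_cast Nat.card_le_card_of_injective _ Subtype.val_injective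

theorem shortOrderProb_mul_le {p q : ℕ} (hp : p.Prime) (hq : q.Prime) (hpq : p ≠ q) {T : ℝ}
    (hT : 0 < T) (hgcd : ((p - 1).gcd (q - 1) : ℝ) ≤ T) :
    shortOrderProb (p * q) (T ^ 3) ≤
      ∑ s ∈ (p - 1).divisors.filter (fun s : ℕ => T < s), (1 / s : ℝ) +
      ∑ s ∈ (q - 1).divisors.filter (fun s : ℕ => T < s), (1 / s : ℝ) := by
  have : Fact p.Prime := ⟨hp⟩
  have : Fact q.Prime := ⟨hq⟩
  have hco : p.Coprime q := (Nat.coprime_primes hp hq).2 hpq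
  have : NeZero (p * q) := ⟨Nat.mul_ne_zero hp.ne_zero hq.ne_zero⟩
  let e : (ZMod (p * q))ˣ ≃* (ZMod p)ˣ × (ZMod q)ˣ :=
    (Units.mapEquiv (ZMod.chineseRemainder hco).toMulEquiv).trans MulEquiv.prodUnits
  have hcp : Nat.card (ZMod p)ˣ = p - 1 := by
    rw [Nat.card_eq_fintype_card, ZMod.card_units]
  have hcq : Nat.card (ZMod q)ˣ = q - 1 := by
    rw [Nat.card_eq_fintype_card, ZMod.card_units]
  have hcN : (Nat.card (ZMod (p * q))ˣ : ℝ) = Nat.card (ZMod p)ˣ * Nat.card (ZMod q)ˣ := by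
    rw [Nat.card_congr e.toEquiv, Nat.card_prod, Nat.cast_mul]
  have hphi : ((p * q).totient : ℝ) = Nat.card (ZMod p)ˣ * Nat.card (ZMod q)ˣ := by
    rw [← hcN, Nat.card_eq_fintype_card, ZMod.card_units_eq_totient]
  have hcard : Nat.card {g : (ZMod (p * q))ˣ //
        (orderOf g : ℝ) < 1 / T ^ 3 * ((p * q).totient : ℝ)} =
      Nat.card {x : (ZMod p)ˣ × (ZMod q)ˣ //
        T ^ 3 * orderOf x < Nat.card (ZMod p)ˣ * Nat.card (ZMod q)ˣ} := by
    refine Nat.card_congr (e.toEquiv.subtypeEquiv fun g => ?_)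
    rw [show orderOf (e.toEquiv g) = orderOf g from e.orderOf_eq g, hphi, one_div,
      lt_inv_mul_iff₀ (by positivity)]
  rw [shortOrderProb, hcard, hcN]
  have hg : ((Nat.card (ZMod p)ˣ).gcd (Nat.card (ZMod q)ˣ) : ℝ) ≤ T := by rwa [hcp, hcq]
  refine (card_orderOf_prod_lt_le hT hg).trans ?_
  have h1 := card_index_gt_le (G := (ZMod p)ˣ) T
  have h2 := card_index_gt_le (G := (ZMod q)ˣ) T
  rw [hcp] at h1 ⊢
  rw [hcq] at h2 ⊢
  exact add_le_add h1 h2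

/-! ### Averaging over the primes -/

theorem primePairs_eq_offDiag (m : ℕ) : primePairs m = (dyadicPrimes m).offDiag := by
  ext ⟨p, q⟩
  simp only [primePairs, dyadicPrimes, Finset.mem_filter, Finset.mem_product, Finset.mem_offDiag]
  tauto

theorem randomShortOrderProb_le_one (m : ℕ) (A : ℝ) : randomShortOrderProb m A ≤ 1 := by
  refine div_le_one_of_le₀ ?_ (Nat.cast_nonneg _)
  refine (Finset.sum_le_card_nsmul _ _ 1 fun pq h => ?_).trans (by simp)
  have h := (Finset.mem_filter.1 h).2
  exact shortOrderProb_le_one (Nat.mul_ne_zero h.1.ne_zero h.2.1.ne_zero) A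

theorem sum_divisors_inv_le {m p : ℕ} (hp : p ∈ dyadicPrimes m) (T : ℝ) :
    ∑ s ∈ (p - 1).divisors.filter (fun s : ℕ => T < s), (1 / s : ℝ) ≤
      ∑ s ∈ (Finset.range (2 ^ m)).filter (fun s : ℕ => T < s),
        if s ∣ p - 1 then (1 / s : ℝ) else 0 := by
  rw [← Finset.sum_filter]
  refine Finset.sum_le_sum_of_subset_of_nonneg (fun s hs => ?_) fun _ _ _ => by positivity
  obtain ⟨h1, h2⟩ := Finset.mem_filter.1 hs
  have h3 := Nat.divisor_le h1
  have h4 := (mem_dyadicPrimes.1 hp).1.2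
  have h5 := (mem_dyadicPrimes.1 hp).2.two_le
  exact Finset.mem_filter.2 ⟨Finset.mem_filter.2 ⟨Finset.mem_range.2 (by omega), h2⟩,
    Nat.dvd_of_mem_divisors h1⟩

/-- The first two terms bound the probability of a large index modulo `p` or `q`; the last one is
at least `1` when `gcd (p - 1) (q - 1)` exceeds `T`. -/
theorem shortOrderProb_le_sum_divisibility {m p q : ℕ} (hp : p ∈ dyadicPrimes m)
    (hq : q ∈ dyadicPrimes m) (hpq : p ≠ q) {T : ℝ} (hT : 0 < T) :
    shortOrderProb (p * q) (T ^ 3) ≤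
      ∑ s ∈ (Finset.range (2 ^ m)).filter (fun s : ℕ => T < s),
        ((if s ∣ p - 1 then (1 / s : ℝ) else 0) + (if s ∣ q - 1 then (1 / s : ℝ) else 0) +
          (if s ∣ p - 1 then 1 else 0) * (if s ∣ q - 1 then 1 else 0)) := by
  have hpp := (mem_dyadicPrimes.1 hp).2
  have hqp := (mem_dyadicPrimes.1 hq).2
  rw [Finset.sum_add_distrib, Finset.sum_add_distrib]
  have hF : ∀ r : ℕ, (0 : ℝ) ≤ ∑ s ∈ (Finset.range (2 ^ m)).filter (fun s : ℕ => T < s),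
      if s ∣ r - 1 then (1 / s : ℝ) else 0 := fun r =>
    Finset.sum_nonneg fun s _ => by positivity
  have hG : ∀ s ∈ (Finset.range (2 ^ m)).filter (fun s : ℕ => T < s),
      (0 : ℝ) ≤ (if s ∣ p - 1 then 1 else 0) * (if s ∣ q - 1 then 1 else 0) :=
    fun s _ => by positivity
  by_cases hgcd : ((p - 1).gcd (q - 1) : ℝ) ≤ T
  · have h1 := shortOrderProb_mul_le hpp hqp hpq hT hgcd
    have h2 := sum_divisors_inv_le hp T
    have h3 := sum_divisors_inv_le hq T
    have h4 := Finset.sum_nonneg hG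
    linarith
  · have h1 := shortOrderProb_le_one (Nat.mul_ne_zero hpp.ne_zero hqp.ne_zero) (T ^ 3)
    have h2 := hF p
    have h3 := hF q
    have hlt : (p - 1).gcd (q - 1) < 2 ^ m := by
      have := (mem_dyadicPrimes.1 hp).1.2
      have := hpp.two_le
      have := Nat.gcd_le_left (q - 1) (show 0 < p - 1 by omega)
      omega
    have h4 := Finset.single_le_sum hG
      (Finset.mem_filter.2 ⟨Finset.mem_range.2 hlt, not_le.1 hgcd⟩)
    simp only [Nat.gcd_dvd_left, Nat.gcd_dvd_right, if_true, mul_one] at h4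
    linarith

theorem sum_shortOrderProb_le (m : ℕ) {T : ℝ} (hT : 0 < T) :
    ∑ pq ∈ primePairs m, shortOrderProb (pq.1 * pq.2) (T ^ 3) ≤
      ∑ s ∈ (Finset.range (2 ^ m)).filter (fun s : ℕ => T < s),
        (2 * (dyadicPrimes m).card *
            ((((dyadicPrimes m).filter (s ∣ · - 1)).card : ℝ) * (1 / s)) +
          (((dyadicPrimes m).filter (s ∣ · - 1)).card : ℝ) ^ 2) := by
  rw [primePairs_eq_offDiag]
  refine (Finset.sum_le_sum fun pq hpq => ?_).trans
    ((Finset.sum_le_sum_of_subset_of_nonneg (t := dyadicPrimes m ×ˢ dyadicPrimes m)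
      (f := fun pq => ∑ s ∈ (Finset.range (2 ^ m)).filter (fun s : ℕ => T < s),
        ((if s ∣ pq.1 - 1 then (1 / s : ℝ) else 0) + (if s ∣ pq.2 - 1 then (1 / s : ℝ) else 0) +
          (if s ∣ pq.1 - 1 then 1 else 0) * (if s ∣ pq.2 - 1 then 1 else 0)))
      (fun pq hpq => ?_) fun _ _ _ => ?_).trans (le_of_eq ?_))
  · obtain ⟨hp, hq, hne⟩ := Finset.mem_offDiag.1 hpq
    exact shortOrderProb_le_sum_divisibility hp hq hne hT
  · obtain ⟨hp, hq, -⟩ := Finset.mem_offDiag.1 hpq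
    exact Finset.mem_product.2 ⟨hp, hq⟩
  · exact Finset.sum_nonneg fun s _ => by positivity
  · rw [Finset.sum_comm]
    refine Finset.sum_congr rfl fun s _ => ?_
    have h1 : ∑ p ∈ dyadicPrimes m, (if s ∣ p - 1 then (1 / s : ℝ) else 0) =
        ((dyadicPrimes m).filter (s ∣ · - 1)).card * (1 / s) := by
      rw [← Finset.sum_filter, Finset.sum_const, nsmul_eq_mul]
    have h2 : ∑ p ∈ dyadicPrimes m, (if s ∣ p - 1 then (1 : ℝ) else 0) =
        ((dyadicPrimes m).filter (s ∣ · - 1)).card := Finset.sum_boole _ _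
    have h3 : ∑ p ∈ dyadicPrimes m, ∑ q ∈ dyadicPrimes m,
        ((if s ∣ p - 1 then (1 : ℝ) else 0) * if s ∣ q - 1 then (1 : ℝ) else 0) =
        (((dyadicPrimes m).filter (s ∣ · - 1)).card : ℝ) ^ 2 := by
      rw [sq, ← h2, Finset.sum_mul_sum]
    rw [Finset.sum_add_distrib, Finset.sum_add_distrib, Finset.sum_product, Finset.sum_product,
      Finset.sum_product]
    dsimp only
    rw [h3, Finset.sum_comm]
    simp only [h1, Finset.sum_const, nsmul_eq_mul]
    ring

theorem randomShortOrderProb_pow_three_le {m : ℕ} (hm : 16 ≤ m) {T : ℝ} (hT : 1 ≤ T) :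
    randomShortOrderProb m (T ^ 3) ≤ 160000 * T ^ (-(3 / 5) : ℝ) := by
  have hT0 : 0 < T := by linarith
  set k := (dyadicPrimes m).card with hk
  have hk2 : 2 ≤ k := by
    by_contra! h
    have h1 := two_pow_le_mul_card_dyadicPrimes hm
    rw [← hk] at h1
    have h2 : 6 * m < 2 ^ m := by
      clear h1 h hk k
      induction m, hm using Nat.le_induction with
      | base => norm_num
      | succ m hm ih => rw [pow_succ 2 m]; omega
    have h3 : 6 * m * k ≤ 6 * m * 1 := Nat.mul_le_mul_left _ (by omega)
    omega
  have hkR : (2 : ℝ) ≤ k := by exact_mod_cast hk2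
  have hcard : ((primePairs m).card : ℝ) = k * k - k := by
    rw [primePairs_eq_offDiag, Finset.offDiag_card, Nat.cast_sub (Nat.le_mul_self _), Nat.cast_mul]
  have hterm : ∀ s ∈ (Finset.range (2 ^ m)).filter (fun s : ℕ => T < s),
      2 * (k : ℝ) * ((((dyadicPrimes m).filter (s ∣ · - 1)).card : ℝ) * (1 / s)) +
          (((dyadicPrimes m).filter (s ∣ · - 1)).card : ℝ) ^ 2 ≤
        19880 * (k : ℝ) ^ 2 * (s : ℝ) ^ (-(8 / 5) : ℝ) := by
    intro s hs
    have hsT := (Finset.mem_filter.1 hs).2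
    have hs1 : (1 : ℝ) ≤ s := by linarith
    have hs0 : (0 : ℝ) < s := by linarith
    have hc := card_dyadicPrimes_modEq_one_le hm (d := s) (by exact_mod_cast hs1)
    rw [← hk] at hc
    have h1 : (1 / s : ℝ) ≤ (s : ℝ) ^ (-(4 / 5) : ℝ) := by
      rw [one_div, ← Real.rpow_neg_one]
      exact Real.rpow_le_rpow_of_exponent_le hs1 (by norm_num)
    have h2 : (s : ℝ) ^ (-(8 / 5) : ℝ) = (s : ℝ) ^ (-(4 / 5) : ℝ) * (s : ℝ) ^ (-(4 / 5) : ℝ) := by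
      rw [← Real.rpow_add hs0]; norm_num
    rw [h2]
    set x := (s : ℝ) ^ (-(4 / 5) : ℝ)
    calc _ ≤ 2 * (k : ℝ) * ((140 * k * x) * x) + (140 * k * x) ^ 2 := by gcongr
      _ = _ := by ring
  rw [randomShortOrderProb, hcard, div_le_iff₀ (by nlinarith)]
  refine ((sum_shortOrderProb_le m hT0).trans (Finset.sum_le_sum hterm)).trans ?_
  rw [← Finset.mul_sum]
  have h1 := sum_rpow_tail_le hT (2 ^ m)
  have h2 : (0 : ℝ) ≤ T ^ (-(3 / 5) : ℝ) := by positivity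
  have h3 : (k : ℝ) ^ 2 ≤ 2 * (k * k - k) := by nlinarith
  calc _ ≤ 19880 * (k : ℝ) ^ 2 * (4 * T ^ (-(3 / 5) : ℝ)) := by gcongr
    _ = 79520 * T ^ (-(3 / 5) : ℝ) * (k : ℝ) ^ 2 := by ring
    _ ≤ 79520 * T ^ (-(3 / 5) : ℝ) * (2 * (k * k - k)) := by gcongr
    _ ≤ _ := by nlinarith

theorem mainTheorem4 :
    ∃ C : ℝ, ∀ (m : ℕ) (A : ℝ), (m : ℝ) ^ 2 ≤ A → A < 2 ^ m - 1 →
      randomShortOrderProb m A ≤ C * ((m : ℝ) ^ (2 / 5 : ℝ) / A ^ (1 / 5 : ℝ)) := by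
  refine ⟨160000, fun m A hmA hAm => ?_⟩
  rcases Nat.eq_zero_or_pos m with rfl | hm0
  · norm_num at hmA hAm
    linarith
  have hm1 : (1 : ℝ) ≤ m := by exact_mod_cast hm0
  have hA1 : 1 ≤ A := (one_le_pow₀ hm1).trans hmA
  have hA0 : 0 < A := by linarith
  suffices h : randomShortOrderProb m A ≤ 160000 * A ^ (-(1 / 5) : ℝ) by
    refine h.trans ?_
    rw [Real.rpow_neg hA0.le, ← one_div]
    gcongr
    exact Real.one_le_rpow hm1 (by norm_num)
  rcases lt_or_ge m 16 with hm | hm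
  -- For `m < 16` the right-hand side exceeds one, since `A < 2 ^ 16 < 16 ^ 5`.
  · refine (randomShortOrderProb_le_one m A).trans ?_
    have h1 : A ≤ 16 ^ (5 : ℝ) := by
      have : (2 : ℝ) ^ m ≤ 2 ^ 16 := pow_le_pow_right₀ (by norm_num) hm.le
      norm_num at this ⊢
      linarith
    have h2 : (16 ^ (5 : ℝ)) ^ (-(1 / 5) : ℝ) ≤ A ^ (-(1 / 5) : ℝ) :=
      Real.rpow_le_rpow_of_nonpos hA0 h1 (by norm_num)
    rw [← Real.rpow_mul (by norm_num), show (5 : ℝ) * -(1 / 5) = -1 by norm_num,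
      Real.rpow_neg_one] at h2
    linarith
  · have h := randomShortOrderProb_pow_three_le hm (T := A ^ (1 / 3 : ℝ))
      (Real.one_le_rpow hA1 (by norm_num))
    rw [← Real.rpow_natCast, ← Real.rpow_mul hA0.le, ← Real.rpow_mul hA0.le] at h
    norm_num at h ⊢
    exact h
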